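/- Let $G$ be a finite graph with vertex set $V$ and edge set $E$ (parallel edges and loops are allowed), whose set of boundary vertices is a disjoint union $V_\partial = A\sqcup B\sqcup C$; the remaining vertices $V_b = V\setminus V_\partial$ are the bulk vertices. Let $D\ge 1$ be an integer. Each edge $e=(vw)$ has two half-edges with Hilbert spaces $\mathcal H_{e,v}=\mathcal H_{e,w}=\mathbb C^D$ and carries the state $|\phi_e\rangle = D^{-1/2}\sum_{i=1}^D|ii\rangle\in\mathcal H_{e,v}\otimes\mathcal H_{e,w}$. For a vertex $v$, let $\mathcal H_v$ be the tensor product of the spaces of all half-edges at $v$, so that $\dim\mathcal H_v=D^{d(v)}$ with $d(v)$ the degree of $v$. Choose independent Haar-random (uniformly distributed) unit vectors $|\psi_v\rangle\in\mathcal H_v$ for $v\in V_b$. The random tensor network state is $$|\Psi\rangle=\Big(I_{V_\partial}\otimes\bigotimes_{v\in V_b}D^{d(v)/2}\langle\psi_v|\Big)\bigotimes_{e\in E}|\phi_e\rangle .$$ Let $\pi^{(1)}=(12)(34)$, $\pi^{(2)}=(13)(24)$, $\pi^{(3)}=(14)(23)$ in $S_4$. For $R\subseteq V_\partial$ and $\pi\in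 S_4$, write $\pi_R$ for the operator that permutes by $\pi$ the four copies of the half-edges at the vertices of $R$, and set $$Z(A:B:C)_{|\Psi\rangle}=\langle\Psi|^{\otimes4}\big(\pi^{(1)}_A\otimes\pi^{(2)}_B\otimes\pi^{(3)}_C\big)|\Psi\rangle^{\otimes4}.$$ A tripartition is a partition $V=\Gamma_A\sqcup\Gamma_B\sqcup\Gamma_C$ (empty parts allowed) with $V_\partial\cap\Gamma_A=A$, $V_\partial\cap\Gamma_B=B$ and $V_\partial\cap\Gamma_C=C$. Its cut $\gamma_{ABC}$ is the set of all edges whose endpoints lie in two different parts. The tripartition is minimal if $|\gamma_{ABC}|$ is minimal among all tripartitions. **Theorem.** Suppose that the minimal tripartition $V=\Gamma_A\sqcup\Gamma_B\sqcup\Gamma_C$ is unique (as a partition of the vertices), and let $\gamma_{ABC}$ be its cut. Then: 1. As $D\to\infty$ with the graph and $A,B,C$ fixed, $$\mathbb E\,Z(A:B:C)_{|\Psi\rangle}=D^{-2|\gamma_{ABC}|}\big(1+O(D^{-1})\big).$$ 2. Consider all configurations $(\pi_v)_{v\in V}\in S_4^V$ with $\pi_v=\pi^{(1)}$ on $A$,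 $\pi_v=\pi^{(2)}$ on $B$ and $\pi_v=\pi^{(3)}$ on $C$, with energy $\sum_{e=(vw)\in E}d(\pi_v,\pi_w)$, where $d(\pi,\sigma)=4-|C(\pi^{-1}\sigma)|$ is the Cayley distance and $|C(\tau)|$ is the number of cycles of $\tau$, fixed points included. The configuration equal to $\pi^{(1)}$ on $\Gamma_A$, $\pi^{(2)}$ on $\Gamma_B$ and $\pi^{(3)}$ on $\Gamma_C$ is the unique configuration of minimal energy, and its energy is $2|\gamma_{ABC}|$. -/

import Mathlib

open MeasureTheory Filter Equiv

namespace RTN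

/-! ### Cayley distance and the three Klein permutations -/

/-- The number of disjoint cycles of a permutation, fixed points included. -/
noncomputable def numCycles {n : ℕ} (σ : Perm (Fin n)) : ℕ :=
  Nat.card (Quotient (Perm.SameCycle.setoid σ))

/-- The Cayley distance on `S_n`; there are at most `n` cycles, so the subtraction is exact. -/
noncomputable def cayleyDist {n : ℕ} (π σ : Perm (Fin n)) : ℕ :=
  n - numCycles (π⁻¹ * σ)

/-- `(1 2)(3 4)`, acting on `{0, 1, 2, 3}`. -/
def klein1 : Perm (Fin 4) := swap 0 1 * swap 2 3

/-- `(1 3)(2 4)`, acting on `{0, 1, 2, 3}`. -/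
def klein2 : Perm (Fin 4) := swap 0 2 * swap 1 3

/-- `(1 4)(2 3)`, acting on `{0, 1, 2, 3}`. -/
def klein3 : Perm (Fin 4) := swap 0 3 * swap 1 2

/-! ### Replicas of a many-body state

The Hilbert space of sites `s : S`, each carrying `ℂ^D`, is `⨂_s ℂ^D`, written in the computational
basis as `EuclideanSpace ℂ (S → Fin D)`. Its `n`-fold tensor power is written in the product basis
as `EuclideanSpace ℂ (Fin n → S → Fin D)`. -/

section Replica

variable {S : Type*} {D : ℕ}

/-- The vector `|Ψ⟩^{⊗ n}`. -/
noncomputable def replicate (n : ℕ) (Ψ : EuclideanSpace ℂ (S → Fin D)) :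
    EuclideanSpace ℂ (Fin n → S → Fin D) :=
  WithLp.toLp 2 fun X => ∏ k, Ψ (X k)

/-- The operator `π_R`, which applies `π` to the `n` copies of the sites in `R` (the content of
copy `k` is moved to copy `π k`) and is the identity on the other sites. -/
noncomputable def permOn [DecidableEq S] {n : ℕ} (R : Finset S) (π : Perm (Fin n)) :
    EuclideanSpace ℂ (Fin n → S → Fin D) →ₗ[ℂ] EuclideanSpace ℂ (Fin n → S → Fin D) where
  toFun Φ := WithLp.toLp 2 fun X => Φ fun k s => if s ∈ R then X (π k) s else X k s
  map_add' _ _ := rfl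
  map_smul' _ _ := rfl

/-- `Z(A:B:C)_Ψ = ⟨Ψ|^{⊗ 4} (π¹_A ⊗ π²_B ⊗ π³_C) |Ψ⟩^{⊗ 4}`, for disjoint sets of sites `A, B, C`
that together make up all of `S`. -/
noncomputable def tripartiteZ [Fintype S] [DecidableEq S] (A B C : Finset S)
    (Ψ : EuclideanSpace ℂ (S → Fin D)) : ℂ :=
  inner ℂ (replicate 4 Ψ)
    (permOn A klein1 (permOn B klein2 (permOn C klein3 (replicate 4 Ψ))))

end Replica

/-- The uniform (unitarily invariant) probability distribution on the unit sphere of `ℂ^ι`: the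
normalized surface measure, obtained from Lebesgue measure by polar coordinates. -/
noncomputable def uniformSphere (ι : Type*) [Fintype ι] :
    Measure (Metric.sphere (0 : EuclideanSpace ℂ ι) 1) :=
  ((volume : Measure (EuclideanSpace ℂ ι)).toSphere Set.univ)⁻¹ •
    (volume : Measure (EuclideanSpace ℂ ι)).toSphere

/-- The maximally entangled state `D^{-1/2} ∑ᵢ |ii⟩` of two sites. -/
noncomputable def maxEntangled (D : ℕ) : EuclideanSpace ℂ (Fin 2 → Fin D) :=
  WithLp.toLp 2 fun x => if x 0 = x 1 then ((Real.sqrt D : ℝ) : ℂ)⁻¹ else 0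

end RTN

/-- A graph with vertex set `V` and edge set `E`, given by the two endpoints of each edge. Parallel
edges and loops are allowed. The order of the two endpoints is immaterial bookkeeping: everything
below is invariant under exchanging them. -/
structure NetworkGraph (V E : Type*) where
  ends : E → Fin 2 → V

namespace NetworkGraph

open RTN

variable {V E : Type*} [Fintype V] [DecidableEq V] [Fintype E] [DecidableEq E]
  (G : NetworkGraph V E)

/-! ### Tripartitions -/

/-- The edges with one endpoint in `X` and the other one in `Y`. -/
def edgesBetween (X Y : Finset V) : Finset E :=
  Finset.univ.filter fun e =>
    (G.ends e 0 ∈ X ∧ G.ends e 1 ∈ Y) ∨ (G.ends e 0 ∈ Y ∧ G.ends e 1 ∈ X)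

/-- The edge set `γ_{ABC} = γ_{AB} ∪ γ_{BC} ∪ γ_{AC}` of a tripartition `(ΓA, ΓB, ΓC)`. -/
def cutEdges (ΓA ΓB ΓC : Finset V) : Finset E :=
  G.edgesBetween ΓA ΓB ∪ G.edgesBetween ΓB ΓC ∪ G.edgesBetween ΓA ΓC

/-- `V = ΓA ∪ ΓB ∪ ΓC` is a partition of the vertices into (possibly empty) disjoint sets that meet
the boundary `V_∂ = A ∪ B ∪ C` in `A`, `B` and `C` respectively. -/
structure IsTripartition (A B C ΓA ΓB ΓC : Finset V) : Prop where
  disjoint_AB : Disjoint ΓA ΓB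
  disjoint_BC : Disjoint ΓB ΓC
  disjoint_AC : Disjoint ΓA ΓC
  union_eq : ΓA ∪ ΓB ∪ ΓC = Finset.univ
  inter_A : (A ∪ B ∪ C) ∩ ΓA = A
  inter_B : (A ∪ B ∪ C) ∩ ΓB = B
  inter_C : (A ∪ B ∪ C) ∩ ΓC = C

/-- A tripartition is minimal if its number of cut edges is minimal among all tripartitions. -/
structure IsMinimalTripartition (A B C ΓA ΓB ΓC : Finset V) : Prop where
  isTripartition : IsTripartition A B C ΓA ΓB ΓC
  card_le : ∀ ΔA ΔB ΔC : Finset V, IsTripartition A B C ΔA ΔB ΔC →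
    (G.cutEdges ΓA ΓB ΓC).card ≤ (G.cutEdges ΔA ΔB ΔC).card

/-! ### Random tensor network states -/

/-- The half-edges at the vertices in `W`; the half-edge `(e, i)` sits at the vertex
`G.ends e i`. -/
abbrev HalfEdgesAt (W : Finset V) : Type _ := {h : E × Fin 2 // G.ends h.1 h.2 ∈ W}

/-- The degree of a vertex: its number of half-edges. -/
def degree (v : V) : ℕ := Fintype.card (G.HalfEdgesAt {v})

/-- The Hilbert space `H_v` of all half-edges at `v`, each of them carrying `ℂ^D`. -/
abbrev VertexSpace (D : ℕ) (v : V) : Type _ := EuclideanSpace ℂ (G.HalfEdgesAt {v} → Fin D)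

/-- A choice of a unit vector `ψ_v` in `H_v` for every bulk vertex, where the bulk vertices are
those outside the set `bdry` of boundary vertices. -/
abbrev BulkTensors (bdry : Finset V) (D : ℕ) : Type _ :=
  (v : {v : V // v ∉ bdry}) → Metric.sphere (0 : G.VertexSpace D v) 1

/-- Independent Haar random bulk tensors. -/
noncomputable def bulkMeasure (bdry : Finset V) (D : ℕ) : Measure (G.BulkTensors bdry D) :=
  Measure.pi fun v => uniformSphere (G.HalfEdgesAt {v.1} → Fin D)

/-- The random tensor network state
`(I ⊗ ⨂_{v bulk} D^{d(v)/2} ⟨ψ_v|) ⨂_e |φ_e⟩`, a vector in the Hilbert space of the half-edges at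
the boundary: its amplitude at the basis vector `x` is a sum over the basis vectors `z` of the space
of all half-edges that agree with `x` at the boundary. -/
noncomputable def rtnState (bdry : Finset V) (D : ℕ) (ψ : G.BulkTensors bdry D) :
    EuclideanSpace ℂ (G.HalfEdgesAt bdry → Fin D) :=
  WithLp.toLp 2 fun x =>
    ∑ z : E × Fin 2 → Fin D,
      if ∀ h : G.HalfEdgesAt bdry, z h.1 = x h then
        (∏ v : {v : V // v ∉ bdry},
          ((Real.sqrt D : ℝ) : ℂ) ^ G.degree v *
            star ((ψ v : G.VertexSpace D v) fun h => z h.1)) *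
        ∏ e : E, maxEntangled D fun i => z (e, i)
      else 0

/-- The boundary half-edges that sit at vertices in the region `A`. -/
def region (bdry A : Finset V) : Finset (G.HalfEdgesAt bdry) :=
  Finset.univ.filter fun h => G.ends h.1.1 h.1.2 ∈ A

/-- The expectation value of `Z(A:B:C)` in the random tensor network state with bond dimension `D`
and boundary `A ∪ B ∪ C`. -/
noncomputable def expectedZ (A B C : Finset V) (D : ℕ) : ℂ :=
  ∫ ψ, tripartiteZ (G.region (A ∪ B ∪ C) A) (G.region (A ∪ B ∪ C) B) (G.region (A ∪ B ∪ C) C)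
    (G.rtnState (A ∪ B ∪ C) D ψ) ∂(G.bulkMeasure (A ∪ B ∪ C) D)

/-! ### The spin model -/

/-- The energy of an `S_n`-valued spin configuration. -/
noncomputable def energy {n : ℕ} (s : V → Perm (Fin n)) : ℕ :=
  ∑ e : E, cayleyDist (s (G.ends e 0)) (s (G.ends e 1))

/-- The boundary conditions: the spins are `π¹`, `π²`, `π³` on `A`, `B`, `C`. -/
def IsAdmissible (A B C : Finset V) (s : V → Perm (Fin 4)) : Prop :=
  (∀ v ∈ A, s v = klein1) ∧ (∀ v ∈ B, s v = klein2) ∧ (∀ v ∈ C, s v = klein3)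

end NetworkGraph

namespace RTN

/-! ### Cycle counts and Cayley distance on `S₄` -/

/-! The fourth moment of a Haar-random unit vector in `ℂ^N` is a sum over `S₄` of index matchings,
divided by `N(N+1)(N+2)(N+3)` (`integral_uniformSphere`). Averaging over all bulk tensors thus
places a spin in `S₄` on every bulk vertex, while boundary spins are frozen to the Klein
permutations. Contracting an edge whose ends carry `π` and `σ` gives `D^(-d(π,σ))`. Hence the mean
of `Z` is exactly the partition function `∑ D^(-energy)` times normalizations tending to 1
(`expectedZ_eq`).

The combinatorial core is a pair of roundings `lowLabel`, `highLabel` of `S₄` onto three labels.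
Both are correct on the Klein permutations, and at each edge the number of roundings that separate
the two spins is at most their Cayley distance. Any admissible configuration therefore has energy at
least the sum of two tripartition cuts, so at least twice the minimal cut. In case of equality both
rounded tripartitions are minimal, hence both are the given one; as the roundings agree only on
Klein permutations, the configuration is the expected one.

Energies are integers, so every other configuration is suppressed by at least one factor `D⁻¹`, and
there are finitely many of them. -/

instance sameCycleSetoidDecidable {n : ℕ} (σ : Perm (Fin n)) :
    DecidableRel (Perm.SameCycle.setoid σ).r :=
  fun a b => inferInstanceAs (Decidable (Perm.SameCycle σ a b))

lemma numCycles_eq_card {n : ℕ} (σ : Perm (Fin n)) :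
    numCycles σ = Fintype.card (Quotient (Perm.SameCycle.setoid σ)) :=
  Nat.card_eq_fintype_card

lemma numCycles_le {n : ℕ} (σ : Perm (Fin n)) : numCycles σ ≤ n := by
  rw [numCycles_eq_card]
  simpa using Fintype.card_quotient_le (Perm.SameCycle.setoid σ)

/-- The kernel can evaluate `Fintype.card` of the quotient, which turns claims about distances in
`S₄` into finite checks. -/
lemma cayleyDist_eq {n : ℕ} (π σ : Perm (Fin n)) :
    cayleyDist π σ = n - Fintype.card (Quotient (Perm.SameCycle.setoid (π⁻¹ * σ))) := by
  rw [cayleyDist, numCycles_eq_card]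

lemma cayleyDist_klein : cayleyDist klein1 klein2 = 2 ∧ cayleyDist klein2 klein1 = 2 ∧
    cayleyDist klein1 klein3 = 2 ∧ cayleyDist klein3 klein1 = 2 ∧
    cayleyDist klein2 klein3 = 2 ∧ cayleyDist klein3 klein2 = 2 ∧
    cayleyDist klein1 klein1 = 0 ∧ cayleyDist klein2 klein2 = 0 ∧
    cayleyDist klein3 klein3 = 0 := by
  simp only [cayleyDist_eq]
  decide +kernel

/-- The Klein permutation with a given label. -/
def klein (i : Fin 3) : Perm (Fin 4) := ![klein1, klein2, klein3] i

lemma cayleyDist_klein_klein (i j : Fin 3) :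
    cayleyDist (klein i) (klein j) = if i ≠ j then 2 else 0 := by
  have h := cayleyDist_klein
  fin_cases i <;> fin_cases j <;> simp [klein, h]

/-- The first of two roundings of `S₄` onto the labels of the three Klein permutations. -/
def lowLabel (σ : Perm (Fin 4)) : Fin 3 :=
  if σ = klein3 then 2
  else if σ = klein2 ∨ σ = swap 0 2 ∨ σ = swap 1 3 ∨ σ * σ = klein1 then 1 else 0

/-- The second of two roundings of `S₄` onto the labels of the three Klein permutations. -/
def highLabel (σ : Perm (Fin 4)) : Fin 3 :=
  if σ = klein1 then 0 else if σ = klein2 ∨ σ * σ = klein3 then 1 else 2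

/-- The two roundings together cut a pair of permutations at most as often as their distance. -/
lemma label_ne_le_cayleyDist (σ τ : Perm (Fin 4)) :
    (if lowLabel σ ≠ lowLabel τ then 1 else 0) + (if highLabel σ ≠ highLabel τ then 1 else 0) ≤
      cayleyDist σ τ := by
  -- The left side never exceeds 2, so the content is that multiplication by a single transposition
  -- never changes both labels. This is verified over all pairs.
  rw [cayleyDist_eq]
  revert σ τ
  decide +kernel

lemma lowLabel_klein (i : Fin 3) : lowLabel (klein i) = i := by
  revert i; decide +kernel

lemma highLabel_klein (i : Fin 3) : highLabel (klein i) = i := by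
  revert i; decide +kernel

/-- The two roundings agree on the Klein permutations only. -/
lemma eq_klein_of_label_eq (σ : Perm (Fin 4)) (i : Fin 3) (hl : lowLabel σ = i)
    (hh : highLabel σ = i) : σ = klein i := by
  revert σ i; decide +kernel

end RTN

set_option linter.unusedSectionVars false

/-! ### Tripartitions as vertex labellings, and the ground state of the spin model -/

namespace NetworkGraph

open RTN

variable {V E : Type*} [Fintype V] [DecidableEq V] [Fintype E] [DecidableEq E]
  (G : NetworkGraph V E)

/-- The vertices with a given label. -/
def part (f : V → Fin 3) (i : Fin 3) : Finset V := Finset.univ.filter fun v => f v = i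

@[simp] lemma mem_part (f : V → Fin 3) (i : Fin 3) (v : V) : v ∈ part f i ↔ f v = i := by
  simp [part]

lemma cutEdges_part (f : V → Fin 3) :
    G.cutEdges (part f 0) (part f 1) (part f 2) =
      Finset.univ.filter fun e => f (G.ends e 0) ≠ f (G.ends e 1) := by
  ext e
  simp only [cutEdges, edgesBetween, Finset.mem_union, Finset.mem_filter, Finset.mem_univ,
    true_and, mem_part]
  generalize f (G.ends e 0) = a
  generalize f (G.ends e 1) = b
  revert a b; decide

lemma card_cutEdges_part (f : V → Fin 3) :
    (G.cutEdges (part f 0) (part f 1) (part f 2)).card =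
      ∑ e, if f (G.ends e 0) ≠ f (G.ends e 1) then 1 else 0 := by
  rw [cutEdges_part, Finset.card_filter]

lemma isTripartition_part {A B C : Finset V} {f : V → Fin 3} (hA : ∀ v ∈ A, f v = 0)
    (hB : ∀ v ∈ B, f v = 1) (hC : ∀ v ∈ C, f v = 2) :
    IsTripartition A B C (part f 0) (part f 1) (part f 2) := by
  refine ⟨?_, ?_, ?_, ?_, ?_, ?_, ?_⟩
  · exact Finset.disjoint_left.2 fun v => by simp +contextual
  · exact Finset.disjoint_left.2 fun v => by simp +contextual
  · exact Finset.disjoint_left.2 fun v => by simp +contextual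
  · ext v
    simp only [Finset.mem_union, mem_part, Finset.mem_univ, iff_true]
    generalize f v = a
    revert a; decide
  all_goals
    ext v
    have := hA v
    have := hB v
    have := hC v
    simp only [Finset.mem_union, Finset.mem_inter, mem_part]
    grind

/-- The label of a vertex in a tripartition. -/
def partLabel (ΓA ΓB : Finset V) (v : V) : Fin 3 := if v ∈ ΓA then 0 else if v ∈ ΓB then 1 else 2

lemma IsTripartition.part_partLabel {A B C ΓA ΓB ΓC : Finset V}
    (h : IsTripartition A B C ΓA ΓB ΓC) : part (partLabel ΓA ΓB) 0 = ΓA ∧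
      part (partLabel ΓA ΓB) 1 = ΓB ∧ part (partLabel ΓA ΓB) 2 = ΓC := by
  have hAB := Finset.disjoint_left.1 h.disjoint_AB
  have hBC := Finset.disjoint_left.1 h.disjoint_BC
  have hAC := Finset.disjoint_left.1 h.disjoint_AC
  have hu (v : V) : v ∈ ΓA ∪ ΓB ∪ ΓC := by rw [h.union_eq]; exact Finset.mem_univ v
  simp only [Finset.mem_union] at hu
  refine ⟨?_, ?_, ?_⟩ <;>
  · ext v
    have := @hAB v
    have := @hBC v
    have := @hAC v
    have := hu v
    simp only [mem_part, partLabel]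
    split_ifs <;> simp_all

/-- Rounding a configuration in two ways bounds its energy from below by two cuts. -/
lemma card_cut_add_card_cut_le_energy (t : V → Perm (Fin 4)) :
    (G.cutEdges (part (lowLabel ∘ t) 0) (part (lowLabel ∘ t) 1) (part (lowLabel ∘ t) 2)).card +
      (G.cutEdges (part (highLabel ∘ t) 0) (part (highLabel ∘ t) 1)
        (part (highLabel ∘ t) 2)).card ≤ G.energy t := by
  rw [card_cutEdges_part, card_cutEdges_part, ← Finset.sum_add_distrib]
  exact Finset.sum_le_sum fun e _ => label_ne_le_cayleyDist _ _

lemma energy_klein (f : V → Fin 3) : G.energy (fun v => klein (f v)) =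
    2 * (G.cutEdges (part f 0) (part f 1) (part f 2)).card := by
  rw [card_cutEdges_part, energy, Finset.mul_sum]
  refine Finset.sum_congr rfl fun e _ => ?_
  rw [cayleyDist_klein_klein]
  split_ifs <;> rfl

/-- Since `g` is correct on the Klein permutations, rounding by `g` turns the boundary conditions on
spins into those on tripartitions. -/
lemma IsAdmissible.isTripartition_part {A B C : Finset V} {t : V → Perm (Fin 4)}
    (ht : IsAdmissible A B C t) {g : Perm (Fin 4) → Fin 3} (hg : ∀ i, g (klein i) = i) :
    IsTripartition A B C (part (g ∘ t) 0) (part (g ∘ t) 1) (part (g ∘ t) 2) := by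
  refine NetworkGraph.isTripartition_part (fun v hv => ?_) (fun v hv => ?_) fun v hv => ?_
  · simpa [ht.1 v hv, klein] using hg 0
  · simpa [ht.2.1 v hv, klein] using hg 1
  · simpa [ht.2.2 v hv, klein] using hg 2

lemma IsMinimalTripartition.exists_unique_min_energy {A B C ΓA ΓB ΓC : Finset V}
    (hmin : G.IsMinimalTripartition A B C ΓA ΓB ΓC)
    (hunique : ∀ ΔA ΔB ΔC : Finset V, G.IsMinimalTripartition A B C ΔA ΔB ΔC →
      ΔA = ΓA ∧ ΔB = ΓB ∧ ΔC = ΓC) :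
    ∃ s : V → Perm (Fin 4),
      (∀ v ∈ ΓA, s v = klein1) ∧ (∀ v ∈ ΓB, s v = klein2) ∧ (∀ v ∈ ΓC, s v = klein3) ∧
      IsAdmissible A B C s ∧ G.energy s = 2 * (G.cutEdges ΓA ΓB ΓC).card ∧
      ∀ t : V → Perm (Fin 4), IsAdmissible A B C t → t ≠ s → G.energy s < G.energy t := by
  obtain ⟨h0, h1, h2⟩ := hmin.isTripartition.part_partLabel
  set f := partLabel ΓA ΓB
  have hA : ∀ v ∈ ΓA, klein (f v) = klein1 := fun v hv => by
    rw [(mem_part f 0 v).1 (h0 ▸ hv)]; rfl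
  have hB : ∀ v ∈ ΓB, klein (f v) = klein2 := fun v hv => by
    rw [(mem_part f 1 v).1 (h1 ▸ hv)]; rfl
  have hC : ∀ v ∈ ΓC, klein (f v) = klein3 := fun v hv => by
    rw [(mem_part f 2 v).1 (h2 ▸ hv)]; rfl
  have hen : G.energy (fun v => klein (f v)) = 2 * (G.cutEdges ΓA ΓB ΓC).card := by
    rw [energy_klein, h0, h1, h2]
  refine ⟨fun v => klein (f v), hA, hB, hC, ⟨fun v hv => ?_, fun v hv => ?_, fun v hv => ?_⟩,
    hen, fun t ht hne => ?_⟩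
  · exact hA v (Finset.mem_inter.1 (hmin.isTripartition.inter_A.symm ▸ hv)).2
  · exact hB v (Finset.mem_inter.1 (hmin.isTripartition.inter_B.symm ▸ hv)).2
  · exact hC v (Finset.mem_inter.1 (hmin.isTripartition.inter_C.symm ▸ hv)).2
  rw [hen]
  by_contra! hle
  have hsum := G.card_cut_add_card_cut_le_energy t
  have hl := ht.isTripartition_part lowLabel_klein
  have hh := ht.isTripartition_part highLabel_klein
  have hl' := hmin.card_le _ _ _ hl
  have hh' := hmin.card_le _ _ _ hh
  -- Each of the two cuts is at least the minimum and together they are at most twice the minimum,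
  -- so both attain it and uniqueness applies.
  have el := hunique _ _ _ ⟨hl, fun ΔA ΔB ΔC hΔ => by
    have := hmin.card_le _ _ _ hΔ
    omega⟩
  have eh := hunique _ _ _ ⟨hh, fun ΔA ΔB ΔC hΔ => by
    have := hmin.card_le _ _ _ hΔ
    omega⟩
  -- A tripartition determines the label of every vertex, so both roundings of `t` coincide with
  -- `f`.
  have key {g : V → Fin 3} (hg : part g 0 = ΓA ∧ part g 1 = ΓB ∧ part g 2 = ΓC) (v : V) :
      g v = f v := by
    have hi : ∀ i, part g i = part f i := by
      intro i
      fin_cases i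
      exacts [hg.1.trans h0.symm, hg.2.1.trans h1.symm, hg.2.2.trans h2.symm]
    exact ((mem_part f (g v) v).1 (hi (g v) ▸ (mem_part g (g v) v).2 rfl)).symm
  exact hne (funext fun v => eq_klein_of_label_eq _ _ (key el v) (key eh v))

end NetworkGraph

namespace RTN

open scoped ComplexConjugate Nat

/-! ### Moments of the complex Gaussian and of the uniform distribution on the sphere -/

/-- The number of permutations that match two words is the product of the factorials of the
multiplicities if the multiplicities agree, and zero otherwise. -/
lemma card_perm_comp_eq {ι : Type*} [Fintype ι] [DecidableEq ι] {n : ℕ}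
    (x y : Fin n → ι) :
    (Finset.univ.filter fun π : Perm (Fin n) => ∀ k, y k = x (π k)).card =
      ∏ i, if (Finset.univ.filter fun k => x k = i).card = (Finset.univ.filter fun k => y k = i).card
        then ((Finset.univ.filter fun k => x k = i).card)! else 0 := by
  by_cases h : ∀ i, (Finset.univ.filter fun k => x k = i).card =
      (Finset.univ.filter fun k => y k = i).card
  · simp only [h, if_true]
    have e : ∀ i, Nonempty ({k // y k = i} ≃ {k // x k = i}) := fun i =>
      Fintype.card_eq.1 (by rw [Fintype.card_subtype, Fintype.card_subtype, h])
    -- `τ` is one matching permutation; all of them form the coset `τ · Stab(y)`, and the stabilizer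
    -- of a word has order the product of the factorials of its multiplicities.
    set τ : Perm (Fin n) := Equiv.ofFiberEquiv fun i => (e i).some
    have hτ (k : Fin n) : x (τ k) = y k := Equiv.ofFiberEquiv_map _ k
    have hc := DomMulAct.stabilizer_card y
    simp only [Fintype.card_subtype] at hc
    rw [← hc]
    refine Finset.card_bij' (fun π _ => τ⁻¹ * π) (fun π _ => τ * π) ?_ ?_ ?_ ?_
    · intro π hπ
      simp only [Finset.mem_filter, Finset.mem_univ, true_and] at hπ ⊢
      funext k
      rw [Function.comp_apply, hπ k, ← hτ, Perm.mul_apply, Perm.inv_def,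
        Equiv.apply_symm_apply]
    · intro π hπ
      simp only [Finset.mem_filter, Finset.mem_univ, true_and] at hπ ⊢
      intro k
      simp only [Perm.mul_apply, hτ]
      exact (congrFun hπ k).symm
    · simp
    · simp
  · rw [Finset.card_eq_zero.2, eq_comm]
    · push Not at h
      obtain ⟨i, hi⟩ := h
      exact Finset.prod_eq_zero (Finset.mem_univ i) (if_neg hi)
    · refine Finset.filter_eq_empty_iff.2 fun π _ hπ => h fun i => ?_
      refine (Finset.card_bij (fun k _ => π k) ?_ (fun _ _ _ _ h => π.injective h) ?_).symm
      · intro k hk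
        simpa [hπ k] using hk
      · intro k hk
        refine ⟨π.symm k, ?_, by simp⟩
        simpa [hπ] using hk

/-- For equal exponents the integrand is radial and yields a Gamma value. For unequal ones a
rotation of the plane multiplies the integral by a phase different from 1. -/
lemma integral_pow_mul_conj_pow_mul_exp (a b : ℕ) :
    ∫ z : ℂ, z ^ a * conj z ^ b * (Real.exp (-‖z‖ ^ 2) : ℂ) =
      if a = b then (Real.pi : ℂ) * a ! else 0 := by
  split_ifs with h
  · subst h
    have h1 := Complex.integral_rpow_mul_exp_neg_rpow (p := 2) (q := 2 * a) (by norm_num)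
      (by have : (0 : ℝ) ≤ a := a.cast_nonneg
          linarith)
    have h2 : ∀ z : ℂ, z ^ a * conj z ^ a * (Real.exp (-‖z‖ ^ 2) : ℂ) =
        ((‖z‖ ^ (2 * a : ℝ) * Real.exp (-‖z‖ ^ (2 : ℝ)) : ℝ) : ℂ) := by
      intro z
      rw [← mul_pow, Complex.mul_conj', Real.rpow_mul (norm_nonneg z)]
      norm_cast
    simp_rw [h2]
    rw [integral_complex_ofReal, h1, show ((2 : ℝ) * a + 2) / 2 = a + 1 by ring,
      Real.Gamma_nat_eq_factorial]
    push_cast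
    ring
  -- The order `a + b + 1` exceeds both exponents, so `u ^ a` and `u ^ b` differ.
  · set u : ℂ := Complex.exp (2 * Real.pi * Complex.I / (a + b + 1 : ℕ)) with hu
    have hp : IsPrimitiveRoot u (a + b + 1) := Complex.isPrimitiveRoot_exp _ (by omega)
    have hn : ‖u‖ = 1 := hp.norm'_eq_one (by omega)
    have hne : u ^ a ≠ u ^ b := fun he => h (hp.pow_inj (by omega) (by omega) he)
    set r : Circle := ⟨u, mem_sphere_zero_iff_norm.2 hn⟩
    have hmp := ((rotation r).measurePreserving).integral_comp
      (rotation r).toHomeomorph.measurableEmbedding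
      (fun z : ℂ => z ^ a * conj z ^ b * (Real.exp (-‖z‖ ^ 2) : ℂ))
    have hr (z : ℂ) : rotation r z = u * z := rfl
    simp only [hr, norm_mul, hn, one_mul, map_mul, mul_pow] at hmp
    set I := ∫ z : ℂ, z ^ a * conj z ^ b * (Real.exp (-‖z‖ ^ 2) : ℂ) with hI
    have hmp' : (u ^ a * conj u ^ b) * I = I := by
      refine Eq.trans ?_ hmp
      rw [hI, ← integral_const_mul]
      congr 1
      ext z
      ring
    have huu : u * conj u = 1 := by rw [Complex.mul_conj', hn]; norm_num
    have : (u ^ a - u ^ b) * I = 0 := by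
      calc (u ^ a - u ^ b) * I = u ^ a * (u * conj u) ^ b * I - u ^ b * I := by
            rw [huu]; ring
        _ = u ^ b * ((u ^ a * conj u ^ b) * I) - u ^ b * I := by rw [mul_pow]; ring
        _ = 0 := by rw [hmp', sub_self]
    exact (mul_eq_zero.1 this).resolve_left (sub_ne_zero.2 hne)

/-- Wick's formula for the standard complex Gaussian. -/
lemma integral_wick {ι : Type*} [Fintype ι] [DecidableEq ι] {n : ℕ} (x y : Fin n → ι) :
    ∫ z : ι → ℂ, (∏ k, z (x k) * conj (z (y k))) * (Real.exp (-∑ i, ‖z i‖ ^ 2) : ℂ) =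
      (Real.pi : ℂ) ^ Fintype.card ι *
        ((Finset.univ.filter fun π : Perm (Fin n) => ∀ k, y k = x (π k)).card : ℂ) := by
  -- Grouping the factors by coordinate leaves only the multiplicities of each index, so the
  -- integral splits into one-variable moments.
  have hf : ∀ z : ι → ℂ,
      (∏ k, z (x k) * conj (z (y k))) * (Real.exp (-∑ i, ‖z i‖ ^ 2) : ℂ) =
      ∏ i, (z i ^ (Finset.univ.filter fun k => x k = i).card *
        conj (z i) ^ (Finset.univ.filter fun k => y k = i).card *
          (Real.exp (-‖z i‖ ^ 2) : ℂ)) := by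
    intro z
    rw [Finset.prod_mul_distrib, Finset.prod_mul_distrib, Finset.prod_mul_distrib,
      ← Finset.sum_neg_distrib, Real.exp_sum, Complex.ofReal_prod]
    congr 2
    · rw [← Finset.prod_fiberwise' Finset.univ x]
      simp
    · rw [← Finset.prod_fiberwise' Finset.univ y (fun i => conj (z i))]
      simp
  simp_rw [hf]
  rw [integral_fintype_prod_volume_eq_prod (fun i (w : ℂ) =>
    w ^ (Finset.univ.filter fun k => x k = i).card *
        conj w ^ (Finset.univ.filter fun k => y k = i).card *
          (Real.exp (-‖w‖ ^ 2) : ℂ)), card_perm_comp_eq]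
  simp_rw [integral_pow_mul_conj_pow_mul_exp]
  push_cast
  rw [← Finset.card_univ, ← Finset.prod_const, ← Finset.prod_mul_distrib]
  refine Finset.prod_congr rfl fun i _ => ?_
  split_ifs <;> simp

/-- Polar coordinates for a positively homogeneous function with Gaussian weight. -/
lemma integral_homogeneous_mul_exp {H : Type*} [NormedAddCommGroup H] [NormedSpace ℝ H]
    [MeasurableSpace H] [BorelSpace H] [FiniteDimensional ℝ H] [Nontrivial H] (μ : Measure H)
    [μ.IsAddHaarMeasure] (F : H → ℂ) (m : ℕ)
    (hF : ∀ (r : ℝ) (w : H), 0 < r → F (r • w) = (r : ℂ) ^ m * F w) :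
    ∫ z, F z * (Real.exp (-‖z‖ ^ 2) : ℂ) ∂μ = (∫ w : Metric.sphere (0 : H) 1, F w ∂μ.toSphere) *
      ((1 / 2 * Real.Gamma ((Module.finrank ℝ H + m : ℝ) / 2) : ℝ) : ℂ) := by
  have hd : 0 < Module.finrank ℝ H := Module.finrank_pos
  set d := Module.finrank ℝ H with hd'
  -- The radial measure has density `r ^ (d - 1)`; together with the homogeneity factor `r ^ m` this
  -- gives the Gamma value at `(d + m) / 2`.
  have hr : ∫ r : Set.Ioi (0 : ℝ), ((r.1 : ℂ) ^ m * (Real.exp (-r.1 ^ 2) : ℂ))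
      ∂(Measure.volumeIoiPow (d - 1)) =
      ((1 / 2 * Real.Gamma ((d + m : ℝ) / 2) : ℝ) : ℂ) := by
    have h1 := integral_rpow_mul_exp_neg_rpow (p := 2) (q := (d - 1 + m : ℕ)) (by norm_num)
      (by have : (0 : ℝ) ≤ (d - 1 + m : ℕ) := Nat.cast_nonneg _
          linarith)
    have h3 : (((d - 1 + m : ℕ) : ℝ) + 1) = d + m := by
      rw [Nat.cast_add, Nat.cast_sub hd]; push_cast; ring
    rw [h3] at h1
    rw [← h1, ← integral_complex_ofReal, Measure.volumeIoiPow,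
      integral_withDensity_eq_integral_toReal_smul (by fun_prop) (by simp)]
    rw [← integral_subtype_comap measurableSet_Ioi (fun r : ℝ =>
      (((r ^ ((d - 1 + m : ℕ) : ℝ) * Real.exp (-r ^ (2 : ℝ)) : ℝ)) : ℂ))]
    refine integral_congr_ae (Eventually.of_forall fun r => ?_)
    have hr : (0 : ℝ) < r.1 := r.2
    simp only
    rw [ENNReal.toReal_ofReal (by positivity), Real.rpow_natCast, Real.rpow_ofNat]
    simp only [Complex.real_smul]
    push_cast
    ring
  set g : Metric.sphere (0 : H) 1 × Set.Ioi (0 : ℝ) → ℂ := fun p =>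
    F p.1 * ((p.2.1 : ℂ) ^ m * (Real.exp (-p.2.1 ^ 2) : ℂ)) with hg
  have hpolar (z : ({(0)}ᶜ : Set H)) :
      g (homeomorphUnitSphereProd H z) = F z * (Real.exp (-‖(z : H)‖ ^ 2) : ℂ) := by
    have hz : 0 < ‖(z : H)‖ := norm_pos_iff.2 z.2
    have h1 : F z = F (‖(z : H)‖ • (‖(z : H)‖⁻¹ • (z : H))) := by
      rw [smul_smul, mul_inv_cancel₀ hz.ne', one_smul]
    rw [h1, hF _ _ hz, hg]
    simp only [homeomorphUnitSphereProd_apply_fst_coe, homeomorphUnitSphereProd_apply_snd_coe]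
    ring
  calc ∫ z, F z * (Real.exp (-‖z‖ ^ 2) : ℂ) ∂μ
      = ∫ z : ({(0)}ᶜ : Set H), F z * (Real.exp (-‖(z : H)‖ ^ 2) : ℂ) ∂(μ.comap (↑)) := by
        rw [integral_subtype_comap (measurableSet_singleton _).compl
          fun z : H => F z * (Real.exp (-‖z‖ ^ 2) : ℂ), restrict_compl_singleton]
    _ = ∫ p, g p ∂μ.toSphere.prod (.volumeIoiPow (d - 1)) := by
        simp_rw [← hpolar]
        exact μ.measurePreserving_homeomorphUnitSphereProd.integral_comp
          (Homeomorph.measurableEmbedding _) g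
    _ = _ := by rw [← hr, ← integral_prod_mul]

section Sphere

variable {ι : Type*} [Fintype ι] [Nonempty ι]

lemma toSphere_volume_univ_ne_zero :
    (volume : Measure (EuclideanSpace ℂ ι)).toSphere Set.univ ≠ 0 :=
  Measure.measure_univ_ne_zero.2 (Measure.toSphere_ne_zero _)

instance isProbabilityMeasure_uniformSphere : IsProbabilityMeasure (uniformSphere ι) :=
  ⟨by
    rw [uniformSphere, Measure.smul_apply, smul_eq_mul]
    exact ENNReal.inv_mul_cancel toSphere_volume_univ_ne_zero (measure_ne_top _ _)⟩

/-- The moments of a uniformly random unit vector in `ℂ^ι`. -/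
lemma integral_uniformSphere [DecidableEq ι] {n : ℕ} (x y : Fin n → ι) :
    ∫ ψ, ∏ k, (ψ : EuclideanSpace ℂ ι) (x k) * conj ((ψ : EuclideanSpace ℂ ι) (y k))
        ∂(uniformSphere ι) =
      ((Finset.univ.filter fun π : Perm (Fin n) => ∀ k, y k = x (π k)).card : ℂ) /
        ((Fintype.card ι).ascFactorial n : ℂ) := by
  set N := Fintype.card ι with hN
  have hNpos : 0 < N := Fintype.card_pos
  let L : (ι → ℂ) ≃L[ℝ] EuclideanSpace ℂ ι :=
    (PiLp.continuousLinearEquiv 2 ℝ (fun _ : ι => ℂ)).symm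
  -- Wick's formula uses the product volume and the sphere measure the Euclidean one. Both are Haar,
  -- hence proportional; the value of `c` is irrelevant, as it cancels below.
  have hc := Measure.isAddLeftInvariant_eq_smul
    (volume : Measure (EuclideanSpace ℂ ι)) ((volume : Measure (ι → ℂ)).map L)
  set c := Measure.addHaarScalarFactor (volume : Measure (EuclideanSpace ℂ ι))
    ((volume : Measure (ι → ℂ)).map L)
  have hdim : Module.finrank ℝ (EuclideanSpace ℂ ι) = 2 * N := by
    rw [finrank_real_of_complex, finrank_euclideanSpace]
  have key {m : ℕ} (x y : Fin m → ι) :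
      ((c : ℝ) : ℂ) * ((Real.pi : ℂ) ^ N *
        ((Finset.univ.filter fun π : Perm (Fin m) => ∀ k, y k = x (π k)).card : ℂ)) =
      (∫ w : Metric.sphere (0 : EuclideanSpace ℂ ι) 1,
        ∏ k, w.1 (x k) * conj (w.1 (y k)) ∂(volume : Measure (EuclideanSpace ℂ ι)).toSphere) *
        (1 / 2 * ((N - 1 + m) ! : ℂ)) := by
    have hp := integral_homogeneous_mul_exp (volume : Measure (EuclideanSpace ℂ ι))
      (fun w => ∏ k, w (x k) * conj (w (y k))) (2 * m) (by
        intro r w _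
        simp only [PiLp.smul_apply, Complex.real_smul, map_mul, Complex.conj_ofReal]
        have h1 (k : Fin m) : (r : ℂ) * w (x k) * (r * conj (w (y k))) =
            r ^ 2 * (w (x k) * conj (w (y k))) := by ring
        simp_rw [h1]
        rw [Finset.prod_mul_distrib, Finset.prod_const, Finset.card_fin, pow_mul])
    have hG : Real.Gamma (((Module.finrank ℝ (EuclideanSpace ℂ ι) : ℝ) + (2 * m : ℕ)) / 2) =
        ((N - 1 + m)! : ℝ) := by
      rw [← Real.Gamma_nat_eq_factorial, hdim]
      congr 1
      rw [Nat.cast_add, Nat.cast_sub hNpos]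
      push_cast
      ring
    rw [hG] at hp
    push_cast at hp
    rw [← integral_wick, ← hp]
    conv_rhs => rw [hc, integral_smul_nnreal_measure,
      show Measure.map L volume = Measure.map L.toHomeomorph volume from rfl,
      L.toHomeomorph.measurableEmbedding.integral_map]
    rw [NNReal.smul_def, Complex.real_smul]
    congr 1
    refine integral_congr_ae (Eventually.of_forall fun z => ?_)
    have hz : ((‖(WithLp.toLp 2 z : EuclideanSpace ℂ ι)‖ : ℝ) : ℂ) ^ 2 =
        ∑ i, ((‖z i‖ : ℝ) : ℂ) ^ 2 := by
      exact_mod_cast EuclideanSpace.norm_sq_eq (WithLp.toLp 2 z : EuclideanSpace ℂ ι)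
    simp [L, hz]
  -- The empty moment is the total mass of the sphere. Dividing the `n`-th identity by it removes
  -- `c`, the power of `π` and the factor `1/2`.
  have h0 := key (m := 0) Fin.elim0 Fin.elim0
  have hn := key x y
  simp only [IsEmpty.forall_iff, Finset.filter_true, Finset.univ_eq_empty, Finset.prod_empty,
    integral_const, add_zero] at h0
  rw [uniformSphere, integral_smul_measure]
  have hM : (volume : Measure (EuclideanSpace ℂ ι)).toSphere.real Set.univ ≠ 0 :=
    (measureReal_ne_zero_iff (measure_ne_top _ _)).2 toSphere_volume_univ_ne_zero
  -- `N.ascFactorial n` starts at `N` itself, so it is `(N - 1 + n)! / (N - 1)!`.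
  have hfac : (((N - 1)! : ℕ) : ℂ) * (N.ascFactorial n : ℂ) = ((N - 1 + n)! : ℕ) := by
    have := Nat.factorial_mul_ascFactorial (N - 1) n
    rw [Nat.sub_add_cancel hNpos] at this
    exact_mod_cast this
  have hf0 : (((N - 1)! : ℕ) : ℂ) ≠ 0 := by exact_mod_cast Nat.factorial_ne_zero _
  have ha0 : (N.ascFactorial n : ℂ) ≠ 0 := by
    have := Nat.ascFactorial_pos (N - 1) n
    rw [Nat.sub_add_cancel hNpos] at this
    exact_mod_cast this.ne'
  have hM' : (((volume : Measure (EuclideanSpace ℂ ι)).toSphere.real Set.univ : ℝ) : ℂ) ≠ 0 := by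
    exact_mod_cast hM
  rw [ENNReal.toReal_inv, ← measureReal_def, Complex.real_smul, Complex.ofReal_inv,
    inv_mul_eq_div, div_eq_div_iff hM' ha0]
  rw [← hfac] at hn
  have h1 : ((Finset.univ : Finset (Perm (Fin 0))).card : ℂ) = 1 := by
    rw [Finset.card_univ, Fintype.card_perm]
    simp
  rw [h1, mul_one, Complex.real_smul, mul_one] at h0
  rw [← mul_assoc, h0] at hn
  refine mul_right_cancel₀ (mul_ne_zero (one_div_ne_zero two_ne_zero) hf0) ?_
  linear_combination -hn

end Sphere

end RTN

namespace RTN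

open scoped ComplexConjugate

/-! ### Replicated contractions -/

/-- The Klein permutations are distinct, so the existence of `σ` already forces `A`, `B`, `C` to be
disjoint; exactly one of the three operators then acts at each site. -/
lemma tripartiteZ_eq_sum {S : Type*} [Fintype S] [DecidableEq S] {D : ℕ} {A B C : Finset S}
    {σ : S → Perm (Fin 4)} (hA : ∀ s ∈ A, σ s = klein1) (hB : ∀ s ∈ B, σ s = klein2)
    (hC : ∀ s ∈ C, σ s = klein3) (hcover : ∀ s, s ∈ A ∨ s ∈ B ∨ s ∈ C)
    (Ψ : EuclideanSpace ℂ (S → Fin D)) :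
    tripartiteZ A B C Ψ =
      ∑ X : Fin 4 → S → Fin D, conj (∏ k, Ψ (X k)) * ∏ k, Ψ fun s => X (σ s k) s := by
  have h12 : klein1 ≠ klein2 := by decide
  have h13 : klein1 ≠ klein3 := by decide
  have h23 : klein2 ≠ klein3 := by decide
  rw [tripartiteZ, PiLp.inner_apply]
  refine Finset.sum_congr rfl fun X _ => ?_
  rw [RCLike.inner_apply']
  refine congrArg₂ (· * ·) rfl ?_
  change (∏ k, Ψ fun s =>
    if s ∈ C then
      if s ∈ B then
        if s ∈ A then X (klein1 (klein2 (klein3 k))) s else X (klein2 (klein3 k)) s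
      else if s ∈ A then X (klein1 (klein3 k)) s else X (klein3 k) s
    else
      if s ∈ B then if s ∈ A then X (klein1 (klein2 k)) s else X (klein2 k) s
      else if s ∈ A then X (klein1 k) s else X k s) = _
  refine Finset.prod_congr rfl fun k _ => congrArg _ (funext fun s => ?_)
  have hA := hA s
  have hB := hB s
  have hC := hC s
  rcases hcover s with h | h | h
  · have hB' : s ∉ B := fun h' => h12 ((hA h).symm.trans (hB h'))
    have hC' : s ∉ C := fun h' => h13 ((hA h).symm.trans (hC h'))
    simp [h, hB', hC', hA]
  · have hA' : s ∉ A := fun h' => h12 ((hA h').symm.trans (hB h))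
    have hC' : s ∉ C := fun h' => h23 ((hB h).symm.trans (hC h'))
    simp [h, hA', hC', hB]
  · have hA' : s ∉ A := fun h' => h13 ((hA h').symm.trans (hC h))
    have hB' : s ∉ B := fun h' => h23 ((hB h').symm.trans (hC h))
    simp [h, hA', hB', hC]

/-- Replicas of an amplitude that is obtained by summing over the extensions `z` of the
configuration `x` along `j`. -/
lemma sum_conj_prod_mul_prod {H S : Type*} [Fintype H] [DecidableEq H] [Fintype S] [DecidableEq S]
    {D n : ℕ} (j : S → H) (σ : S → Perm (Fin n)) (F : (H → Fin D) → ℂ) (Ψ : (S → Fin D) → ℂ)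
    (hΨ : ∀ x, Ψ x = ∑ z, if ∀ s, z (j s) = x s then F z else 0) :
    ∑ X : Fin n → S → Fin D, conj (∏ k, Ψ (X k)) * ∏ k, Ψ (fun s => X (σ s k) s) =
      ∑ W : Fin n → H → Fin D, ∑ Y : Fin n → H → Fin D,
        if ∀ k s, Y k (j s) = W (σ s k) (j s) then ∏ k, conj (F (W k)) * F (Y k) else 0 := by
  have hprod (X : Fin n → S → Fin D) : ∏ k, Ψ (X k) =
      ∑ W : Fin n → H → Fin D, if ∀ k s, W k (j s) = X k s then ∏ k, F (W k) else 0 := by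
    simp_rw [hΨ]
    rw [Finset.prod_univ_sum, Fintype.piFinset_univ]
    refine Finset.sum_congr rfl fun W _ => ?_
    split_ifs with h
    · exact Finset.prod_congr rfl fun k _ => if_pos (h k)
    · push Not at h
      obtain ⟨k, s, hs⟩ := h
      exact Finset.prod_eq_zero (Finset.mem_univ k) (if_neg fun h => hs (h s))
  simp_rw [hprod, map_sum, Finset.sum_mul]
  rw [Finset.sum_comm]
  refine Finset.sum_congr rfl fun W _ => ?_
  -- The extension `W` determines the boundary configuration `X`, so the sum over `X` collapses.
  rw [Finset.sum_eq_single fun k s => W k (j s)]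
  · simp only [implies_true, if_true]
    rw [Finset.mul_sum]
    refine Finset.sum_congr rfl fun Y _ => ?_
    rw [mul_ite, mul_zero, map_prod, Finset.prod_mul_distrib]
  · intro X _ hX
    rw [if_neg, map_zero, zero_mul]
    exact fun h => hX (funext fun k => funext fun s => (h k s).symm)
  · simp

/-- Functions that are invariant under a permutation are functions on its cycles. -/
lemma card_invariant {D n : ℕ} (τ : Perm (Fin n)) :
    (Finset.univ.filter fun u : Fin n → Fin D => ∀ k, u k = u (τ k)).card = D ^ numCycles τ := by
  rw [← Fintype.card_subtype]
  have e : {u : Fin n → Fin D // ∀ k, u k = u (τ k)} ≃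
      (Quotient (Perm.SameCycle.setoid τ) → Fin D) :=
    { toFun := fun u => Quotient.lift u.1 (by
        rintro a b ⟨i, rfl⟩
        have h (m : ℕ) (c : Fin n) : u.1 c = u.1 ((τ ^ m) c) := by
          induction m with
          | zero => rfl
          | succ m ih => rw [pow_succ', Perm.mul_apply, ← u.2, ih]
        rcases i with m | m
        · simpa using h m a
        · have := h (m + 1) ((τ ^ (Int.negSucc m)) a)
          rw [this, zpow_negSucc, ← Perm.mul_apply, mul_inv_cancel, Perm.one_apply])
      invFun := fun f => ⟨fun k => f (Quotient.mk _ k), fun k =>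
        congrArg f (Quotient.sound ⟨1, by simp⟩)⟩
      left_inv := fun u => rfl
      right_inv := fun f => by
        funext q
        induction q using Quotient.inductionOn
        rfl }
  rw [Fintype.card_congr e, Fintype.card_fun, Fintype.card_fin, numCycles_eq_card]

/-- The contribution of one edge whose ends are acted on by `p 0` and `p 1`. -/
lemma sum_maxEntangled {D n : ℕ} [NeZero D] (p : Fin 2 → Perm (Fin n)) :
    ∑ w : Fin n → Fin 2 → Fin D,
      ∏ k, conj (maxEntangled D (w k)) * maxEntangled D (fun i => w (p i k) i) =
        ((D : ℂ) ^ cayleyDist (p 0) (p 1))⁻¹ := by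
  have hD : (D : ℂ) ≠ 0 := NeZero.ne _
  have hterm (w : Fin n → Fin 2 → Fin D) :
      ∏ k, conj (maxEntangled D (w k)) * maxEntangled D (fun i => w (p i k) i) =
        if (∀ k, w k 0 = w k 1) ∧ ∀ k, w (p 0 k) 0 = w (p 1 k) 1 then ((D : ℂ) ^ n)⁻¹ else 0 := by
    simp only [maxEntangled]
    split_ifs with h
    · have h1 (k : Fin n) : conj (if w k 0 = w k 1 then ((Real.sqrt D : ℝ) : ℂ)⁻¹ else 0) *
          (if w (p 0 k) 0 = w (p 1 k) 1 then ((Real.sqrt D : ℝ) : ℂ)⁻¹ else 0) = (D : ℂ)⁻¹ := by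
        rw [if_pos (h.1 k), if_pos (h.2 k), map_inv₀, Complex.conj_ofReal, ← mul_inv,
          ← Complex.ofReal_mul, Real.mul_self_sqrt (Nat.cast_nonneg D), Complex.ofReal_natCast]
      simp_rw [h1]
      rw [Finset.prod_const, Finset.card_fin, inv_pow]
    · rw [not_and_or] at h
      push Not at h
      rcases h with ⟨k, hk⟩ | ⟨k, hk⟩ <;>
      exact Finset.prod_eq_zero (Finset.mem_univ k) (by simp [hk])
  simp_rw [hterm]
  rw [← Finset.sum_filter, Finset.sum_const, nsmul_eq_mul]
  -- The first condition merges the two ends into one word. Reading it along `p 0` turns the second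
  -- condition into invariance under `(p 0)⁻¹ * p 1`, leaving one free index per cycle against the
  -- normalization `D ^ (-n)`.
  have hcard : (Finset.univ.filter fun w : Fin n → Fin 2 → Fin D =>
      (∀ k, w k 0 = w k 1) ∧ ∀ k, w (p 0 k) 0 = w (p 1 k) 1).card =
      (Finset.univ.filter fun u : Fin n → Fin D => ∀ k, u k = u (((p 0)⁻¹ * p 1) k)).card := by
    refine Finset.card_bij' (fun w _ k => w (p 0 k) 0) (fun u _ k _ => u ((p 0)⁻¹ k)) ?_ ?_ ?_ ?_
    · intro w hw
      simp only [Finset.mem_filter, Finset.mem_univ, true_and] at hw ⊢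
      intro k
      simp [hw.2 k, hw.1]
    · intro u hu
      simp only [Finset.mem_filter, Finset.mem_univ, true_and] at hu ⊢
      refine ⟨fun _ => trivial, fun k => ?_⟩
      simpa using hu k
    · intro w hw
      simp only [Finset.mem_filter, Finset.mem_univ, true_and] at hw
      funext k i
      fin_cases i <;> simp [hw.1]
    · intro u _
      funext k
      simp
  rw [hcard, card_invariant, cayleyDist, Nat.cast_pow]
  have hle := numCycles_le ((p 0)⁻¹ * p 1)
  rw [pow_sub₀ _ hD hle]
  field_simp

end RTN

namespace NetworkGraph

open RTN

open scoped ComplexConjugate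

variable {V E : Type*} [Fintype V] [DecidableEq V] [Fintype E] [DecidableEq E]
  (G : NetworkGraph V E)

/-! ### The average as a partition function -/

/-- The basis state of all half-edges restricted to those at the vertex `v`. -/
def localState {D : ℕ} (v : V) (z : E × Fin 2 → Fin D) : G.HalfEdgesAt {v} → Fin D :=
  fun h => z h.1

/-- The amplitude of the bulk tensor at `v`, rescaled by the square root of the dimension. -/
noncomputable def localAmplitude {D : ℕ} (v : V)
    (φ : Metric.sphere (0 : G.VertexSpace D v) 1) (z : E × Fin 2 → Fin D) : ℂ :=
  ((Real.sqrt D : ℝ) : ℂ) ^ G.degree v * star ((φ : G.VertexSpace D v) (G.localState v z))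

/-- The amplitude of the product of the edge states. -/
noncomputable def edgeAmplitude {D : ℕ} (z : E × Fin 2 → Fin D) : ℂ :=
  ∏ e : E, maxEntangled D fun i => z (e, i)

/-- The ratio between `N ^ n` and the rising factorial `N (N + 1) ⋯ (N + n - 1)`. -/
noncomputable def _root_.RTN.risingRatio (n N : ℕ) : ℝ := (N : ℝ) ^ n / N.ascFactorial n

lemma card_localBasis (D : ℕ) (v : V) :
    Fintype.card (G.HalfEdgesAt {v} → Fin D) = D ^ G.degree v := by
  rw [Fintype.card_fun, Fintype.card_fin, degree]

/-- The rescaling contributes the dimension once per replica, which nearly cancels the rising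
factorial in the moment formula. The amplitude contains the conjugate of `φ`, so the conjugated
copies `W` supply the unconjugated entries. -/
lemma integral_localAmplitude {D n : ℕ} [NeZero D] (v : V) (W Y : Fin n → E × Fin 2 → Fin D) :
    ∫ φ, ∏ k, conj (G.localAmplitude v φ (W k)) * G.localAmplitude v φ (Y k)
        ∂(uniformSphere (G.HalfEdgesAt {v} → Fin D)) =
      (risingRatio n (D ^ G.degree v) : ℂ) * ∑ π : Perm (Fin n),
        if ∀ k, G.localState v (Y k) = G.localState v (W (π k)) then 1 else 0 := by
  have hterm (φ : Metric.sphere (0 : G.VertexSpace D v) 1) :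
      ∏ k, conj (G.localAmplitude v φ (W k)) * G.localAmplitude v φ (Y k) =
        ((D ^ G.degree v : ℕ) : ℂ) ^ n * ∏ k, (φ : G.VertexSpace D v) (G.localState v (W k)) *
          conj ((φ : G.VertexSpace D v) (G.localState v (Y k))) := by
    have hs : ((Real.sqrt D : ℝ) : ℂ) ^ G.degree v * ((Real.sqrt D : ℝ) : ℂ) ^ G.degree v =
        ((D ^ G.degree v : ℕ) : ℂ) := by
      rw [← mul_pow, ← Complex.ofReal_mul, Real.mul_self_sqrt (Nat.cast_nonneg D)]
      push_cast
      rfl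
    have h1 (k : Fin n) : conj (G.localAmplitude v φ (W k)) * G.localAmplitude v φ (Y k) =
        ((D ^ G.degree v : ℕ) : ℂ) * ((φ : G.VertexSpace D v) (G.localState v (W k)) *
          conj ((φ : G.VertexSpace D v) (G.localState v (Y k)))) := by
      rw [← hs, localAmplitude, localAmplitude, map_mul, map_pow, Complex.conj_ofReal]
      simp only [← starRingEnd_apply, Complex.conj_conj]
      ring
    simp_rw [h1]
    rw [Finset.prod_mul_distrib, Finset.prod_const, Finset.card_fin]
  simp_rw [hterm]
  rw [integral_const_mul, integral_uniformSphere, G.card_localBasis, risingRatio,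
    ← Finset.sum_filter, Finset.sum_const, nsmul_eq_mul, mul_one]
  push_cast
  rw [mul_div_assoc', div_mul_eq_mul_div]

/-- The spins that a vertex may carry if the spins on the boundary are those of `σ`. -/
def allowedSpins {n : ℕ} (bdry : Finset V) (σ : V → Perm (Fin n)) (v : V) :
    Finset (Perm (Fin n)) :=
  if v ∈ bdry then {σ v} else Finset.univ

/-- Expanding the product of sums chooses one permutation per bulk vertex, while boundary vertices
have a single choice. Every half-edge sits at exactly one vertex, so the local matching conditions
together determine `Y` from `W`. -/
lemma boundary_mul_prod_bulk {D n : ℕ} (bdry : Finset V) (σ : V → Perm (Fin n))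
    (W Y : Fin n → E × Fin 2 → Fin D) :
    (if ∀ k (h : G.HalfEdgesAt bdry), Y k h.1 = W (σ (G.ends h.1.1 h.1.2) k) h.1
      then (1 : ℂ) else 0) *
      ∏ v : {v : V // v ∉ bdry}, ∑ π : Perm (Fin n),
        (if ∀ k, G.localState v.1 (Y k) = G.localState v.1 (W (π k)) then (1 : ℂ) else 0) =
      ∑ s ∈ Fintype.piFinset (allowedSpins bdry σ),
        if Y = fun k h => W (s (G.ends h.1 h.2) k) h then 1 else 0 := by
  have hlocal (v : V) (π : Perm (Fin n)) :
      (∀ k, G.localState v (Y k) = G.localState v (W (π k))) ↔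
        ∀ k (h : E × Fin 2), G.ends h.1 h.2 = v → Y k h = W (π k) h := by
    refine forall_congr' fun k => ⟨fun H h hv => ?_, fun H => funext fun h => ?_⟩
    · exact congrFun H ⟨h, by simpa using hv⟩
    · exact H h.1 (by simpa using h.2)
  have hs (s : V → Perm (Fin n)) :
      (if Y = fun k h => W (s (G.ends h.1 h.2) k) h then (1 : ℂ) else 0) =
        ∏ v, if ∀ k, G.localState v (Y k) = G.localState v (W (s v k)) then 1 else 0 := by
    rw [Fintype.prod_ite_zero, Finset.prod_const_one]
    refine if_congr ?_ rfl rfl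
    simp_rw [hlocal]
    exact ⟨fun H v k h hv => by rw [H]; simp only [hv],
      fun H => funext fun k => funext fun h => H _ k h rfl⟩
  simp_rw [hs]
  rw [← Finset.prod_univ_sum (allowedSpins bdry σ) fun v π =>
      if ∀ k, G.localState v (Y k) = G.localState v (W (π k)) then (1 : ℂ) else 0,
    ← Fintype.prod_subtype_mul_prod_subtype (fun v => v ∉ bdry), mul_comm]
  congr 1
  · refine Finset.prod_congr rfl fun v _ => ?_
    rw [allowedSpins, if_neg v.2]
  · have h1 (v : {v // ¬ v ∉ bdry}) : ∑ π ∈ allowedSpins bdry σ v.1,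
        (if ∀ k, G.localState v.1 (Y k) = G.localState v.1 (W (π k)) then (1 : ℂ) else 0) =
        if ∀ k, G.localState v.1 (Y k) = G.localState v.1 (W (σ v.1 k)) then (1 : ℂ) else 0 := by
      rw [allowedSpins, if_pos (not_not.1 v.2), Finset.sum_singleton]
    simp_rw [h1]
    rw [Fintype.prod_ite_zero, Finset.prod_const_one]
    refine if_congr ?_ rfl rfl
    simp_rw [hlocal]
    exact ⟨fun H v k h hv => by rw [H k ⟨h, hv ▸ not_not.1 v.2⟩]; simp only [hv],
      fun H k h => H ⟨_, not_not.2 h.2⟩ k h.1 rfl⟩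

/-- Contracting all edges for a fixed spin configuration gives its Boltzmann weight. -/
lemma sum_edgeAmplitude {D n : ℕ} [NeZero D] (s : V → Perm (Fin n)) :
    ∑ W : Fin n → E × Fin 2 → Fin D, ∏ k, conj (edgeAmplitude (W k)) *
        edgeAmplitude (fun h => W (s (G.ends h.1 h.2) k) h) =
      ((D : ℂ) ^ G.energy s)⁻¹ := by
  rw [energy, ← Finset.prod_pow_eq_pow_sum, ← Finset.prod_inv_distrib]
  have hedge (e : E) := sum_maxEntangled (D := D) fun i => s (G.ends e i)
  simp_rw [← hedge]
  rw [Finset.prod_univ_sum, Fintype.piFinset_univ]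
  let r : (Fin n → E × Fin 2 → Fin D) ≃ (E → Fin n → Fin 2 → Fin D) :=
    { toFun := fun W e k i => W k (e, i)
      invFun := fun w k h => w h.1 k h.2
      left_inv := fun _ => rfl
      right_inv := fun _ => rfl }
  refine Fintype.sum_equiv r _ _ fun W => ?_
  simp only [edgeAmplitude, map_prod]
  rw [Finset.prod_comm]
  refine Finset.prod_congr rfl fun k _ => ?_
  rw [← Finset.prod_mul_distrib]
  rfl

/-- The averaged `Z` is the partition function of the spin model, up to the normalization factors
of the bulk tensors. -/
theorem expectedZ_eq {A B C : Finset V} {D : ℕ} [NeZero D] {σ : V → Perm (Fin 4)}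
    (hσ : IsAdmissible A B C σ) :
    G.expectedZ A B C D =
      (∏ v : {v : V // v ∉ A ∪ B ∪ C}, (risingRatio 4 (D ^ G.degree v.1) : ℂ)) *
        ∑ s ∈ Fintype.piFinset (allowedSpins (A ∪ B ∪ C) σ), ((D : ℂ) ^ G.energy s)⁻¹ := by
  set bdry := A ∪ B ∪ C with hbdry
  have hexpand (ψ : G.BulkTensors bdry D) :
      tripartiteZ (G.region bdry A) (G.region bdry B) (G.region bdry C) (G.rtnState bdry D ψ) =
        ∑ W : Fin 4 → E × Fin 2 → Fin D, ∑ Y : Fin 4 → E × Fin 2 → Fin D,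
          (if ∀ k (h : G.HalfEdgesAt bdry), Y k h.1 = W (σ (G.ends h.1.1 h.1.2) k) h.1
            then ∏ k, conj (edgeAmplitude (W k)) * edgeAmplitude (Y k) else 0) *
          ∏ v : {v : V // v ∉ bdry}, ∏ k, conj (G.localAmplitude v.1 (ψ v) (W k)) *
            G.localAmplitude v.1 (ψ v) (Y k) := by
    rw [tripartiteZ_eq_sum (σ := fun h : G.HalfEdgesAt bdry => σ (G.ends h.1.1 h.1.2))
      (fun h hh => hσ.1 _ (by simpa [region] using hh))
      (fun h hh => hσ.2.1 _ (by simpa [region] using hh))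
      (fun h hh => hσ.2.2 _ (by simpa [region] using hh))
      (fun h => by simpa [region, hbdry, or_assoc] using h.2)]
    refine (sum_conj_prod_mul_prod (fun h : G.HalfEdgesAt bdry => h.1)
      (fun h => σ (G.ends h.1.1 h.1.2))
      (fun z => (∏ v : {v : V // v ∉ bdry}, G.localAmplitude v.1 (ψ v) z) * edgeAmplitude z)
      (fun x => G.rtnState bdry D ψ x) (fun x => rfl)).trans ?_
    refine Finset.sum_congr rfl fun W _ => Finset.sum_congr rfl fun Y _ => ?_
    rw [ite_mul, zero_mul]
    refine if_congr Iff.rfl ?_ rfl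
    rw [Finset.prod_comm, ← Finset.prod_mul_distrib]
    refine Finset.prod_congr rfl fun k _ => ?_
    rw [map_mul, map_prod, Finset.prod_mul_distrib]
    ring
  -- The amplitudes are continuous on compact spheres.
  have hint (W Y : Fin 4 → E × Fin 2 → Fin D) : Integrable (fun ψ : G.BulkTensors bdry D =>
      ∏ v : {v : V // v ∉ bdry}, ∏ k, conj (G.localAmplitude v.1 (ψ v) (W k)) *
        G.localAmplitude v.1 (ψ v) (Y k)) (G.bulkMeasure bdry D) := by
    refine Integrable.fintype_prod_dep (f := fun (v : {v : V // v ∉ bdry})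
      (φ : Metric.sphere (0 : G.VertexSpace D v.1) 1) =>
        ∏ k, conj (G.localAmplitude v.1 φ (W k)) * G.localAmplitude v.1 φ (Y k)) fun v => ?_
    refine Continuous.integrable_of_hasCompactSupport ?_ (HasCompactSupport.of_compactSpace _)
    simp only [localAmplitude]
    fun_prop
  rw [expectedZ, ← hbdry]
  simp_rw [hexpand]
  rw [integral_finsetSum _ fun W _ => integrable_finsetSum _ fun Y _ => (hint W Y).const_mul _]
  refine (Finset.sum_congr rfl fun W _ =>
    (integral_finsetSum _ fun Y _ => (hint W Y).const_mul _).trans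
      (Finset.sum_congr rfl fun Y _ => integral_const_mul _ _)).trans ?_
  have hprod (W Y : Fin 4 → E × Fin 2 → Fin D) : ∫ ψ : G.BulkTensors bdry D,
      ∏ v : {v : V // v ∉ bdry}, ∏ k, conj (G.localAmplitude v.1 (ψ v) (W k)) *
        G.localAmplitude v.1 (ψ v) (Y k) ∂(G.bulkMeasure bdry D) =
      (∏ v : {v : V // v ∉ bdry}, (risingRatio 4 (D ^ G.degree v.1) : ℂ)) *
        ∏ v : {v : V // v ∉ bdry}, ∑ π : Perm (Fin 4),
          if ∀ k, G.localState v.1 (Y k) = G.localState v.1 (W (π k)) then 1 else 0 := by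
    -- Independence of the bulk tensors: the mean factors over vertices.
    rw [bulkMeasure, integral_fintype_prod_eq_prod (fun (v : {v : V // v ∉ bdry})
      (φ : Metric.sphere (0 : G.VertexSpace D v.1) 1) =>
        ∏ k, conj (G.localAmplitude v.1 φ (W k)) * G.localAmplitude v.1 φ (Y k)),
      ← Finset.prod_mul_distrib]
    exact Finset.prod_congr rfl fun v _ => G.integral_localAmplitude v.1 W Y
  have hterm (W Y : Fin 4 → E × Fin 2 → Fin D) (c : ℂ) :
      (if ∀ k (h : G.HalfEdgesAt bdry), Y k h.1 = W (σ (G.ends h.1.1 h.1.2) k) h.1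
        then ∏ k, conj (edgeAmplitude (W k)) * edgeAmplitude (Y k) else 0) *
        (c * ∏ v : {v : V // v ∉ bdry}, ∑ π : Perm (Fin 4),
          if ∀ k, G.localState v.1 (Y k) = G.localState v.1 (W (π k)) then 1 else 0) =
      c * ∑ s ∈ Fintype.piFinset (allowedSpins bdry σ),
        if Y = fun k h => W (s (G.ends h.1 h.2) k) h then
          ∏ k, conj (edgeAmplitude (W k)) * edgeAmplitude (Y k) else 0 := by
    have h := G.boundary_mul_prod_bulk bdry σ W Y
    simp_rw [← mul_boole _ (∏ k, conj (edgeAmplitude (W k)) * edgeAmplitude (Y k))]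
    rw [← Finset.mul_sum, ← h]
    ring
  simp_rw [hprod, hterm, ← Finset.mul_sum]
  congr 1
  simp_rw [← G.sum_edgeAmplitude]
  conv_rhs => rw [Finset.sum_comm]
  refine Finset.sum_congr rfl fun W _ => ?_
  rw [Finset.sum_comm]
  refine Finset.sum_congr rfl fun s _ => ?_
  -- Once `W` and `s` are fixed, a single `Y` survives.
  rw [Finset.sum_ite_eq' Finset.univ]
  simp

end NetworkGraph

namespace RTN

/-! ### Asymptotics -/

lemma isBigO_mul_sub_one {f g : ℕ → ℝ}
    (hf : (fun D => f D - 1) =O[atTop] fun D : ℕ => (D : ℝ)⁻¹)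
    (hg : (fun D => g D - 1) =O[atTop] fun D : ℕ => (D : ℝ)⁻¹) :
    (fun D => f D * g D - 1) =O[atTop] fun D : ℕ => (D : ℝ)⁻¹ := by
  have h1 : (fun D : ℕ => (D : ℝ)⁻¹) =O[atTop] fun _ => (1 : ℝ) :=
    (tendsto_inv_atTop_nhds_zero_nat (𝕜 := ℝ)).isBigO_one ℝ
  have hfg := (hf.mul (hg.trans h1)).congr_right (g₂ := fun D : ℕ => (D : ℝ)⁻¹) fun D => by simp
  exact ((hfg.add hf).add hg).congr_left fun D => by ring

lemma isBigO_prod_sub_one {ι : Type*} (t : Finset ι) (f : ι → ℕ → ℝ)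
    (hf : ∀ i ∈ t, (fun D => f i D - 1) =O[atTop] fun D : ℕ => (D : ℝ)⁻¹) :
    (fun D => (∏ i ∈ t, f i D) - 1) =O[atTop] fun D : ℕ => (D : ℝ)⁻¹ := by
  classical
  induction t using Finset.induction_on with
  | empty => simpa using Asymptotics.isBigO_zero _ _
  | insert i t hi ih =>
    simp_rw [Finset.prod_insert hi]
    exact isBigO_mul_sub_one (hf i (Finset.mem_insert_self i t))
      (ih fun j hj => hf j (Finset.mem_insert_of_mem hj))

/-- For `d = 0` the ratio is the constant `1/24`; uniqueness of the ground state excludes isolated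
bulk vertices, so this case does not arise. -/
lemma isBigO_risingRatio_sub_one {d : ℕ} (hd : d ≠ 0) :
    (fun D : ℕ => risingRatio 4 (D ^ d) - 1) =O[atTop] fun D : ℕ => (D : ℝ)⁻¹ := by
  -- The constant is `1 + 2 + 3`, the leading coefficient of `(N+1)(N+2)(N+3) - N³`.
  refine Asymptotics.IsBigO.of_bound 6 ?_
  filter_upwards [eventually_ge_atTop 1] with D hD
  have hD' : (1 : ℝ) ≤ D := by exact_mod_cast hD
  have hN : (D : ℝ) ≤ ((D ^ d : ℕ) : ℝ) := by exact_mod_cast Nat.le_self_pow hd D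
  rw [risingRatio]
  generalize D ^ d = N at hN
  have hN0 : (0 : ℝ) < N := by linarith
  have hasc : ((N.ascFactorial 4 : ℕ) : ℝ) = N * (N + 1) * (N + 2) * (N + 3) := by
    simp [Nat.ascFactorial]
    ring
  rw [hasc, Real.norm_eq_abs, Real.norm_eq_abs, abs_of_nonneg (by positivity : (0 : ℝ) ≤ (D : ℝ)⁻¹)]
  have h1 : (N : ℝ) ^ 4 / (N * (N + 1) * (N + 2) * (N + 3)) - 1 =
      -((6 * N ^ 2 + 11 * N + 6) / ((N + 1) * (N + 2) * (N + 3))) := by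
    field_simp
    ring
  rw [h1, abs_neg, abs_of_nonneg (by positivity)]
  calc (6 * (N : ℝ) ^ 2 + 11 * N + 6) / ((N + 1) * (N + 2) * (N + 3)) ≤ 6 * (N : ℝ)⁻¹ := by
        rw [← div_eq_mul_inv, div_le_div_iff₀ (by positivity) hN0]
        nlinarith [sq_nonneg (N : ℝ)]
    _ ≤ 6 * (D : ℝ)⁻¹ := by gcongr

/-- Exponents are integers, so a strict gap is at least 1: relative to the leading term, each of the
finitely many others is at most `D⁻¹`. -/
lemma isBigO_sum_sub_one {ι : Type*} [DecidableEq ι] {t : Finset ι} {i₀ : ι} (hi₀ : i₀ ∈ t)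
    (a : ι → ℕ) (ha : ∀ i ∈ t, i ≠ i₀ → a i₀ < a i) :
    (fun D : ℕ => (D : ℝ) ^ a i₀ * ∑ i ∈ t, ((D : ℝ) ^ a i)⁻¹ - 1) =O[atTop]
      fun D : ℕ => (D : ℝ)⁻¹ := by
  have h : (fun D : ℕ => ∑ i ∈ t.erase i₀, (D : ℝ) ^ a i₀ * ((D : ℝ) ^ a i)⁻¹) =O[atTop]
      fun D : ℕ => (D : ℝ)⁻¹ := by
    refine Asymptotics.IsBigO.fun_sum fun i hi => Asymptotics.IsBigO.of_bound 1 ?_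
    filter_upwards [eventually_ge_atTop 1] with D hD
    have hD' : (1 : ℝ) ≤ D := by exact_mod_cast hD
    have hlt := ha i (Finset.mem_of_mem_erase hi) (Finset.ne_of_mem_erase hi)
    rw [one_mul, Real.norm_of_nonneg (by positivity), Real.norm_of_nonneg (by positivity),
      ← div_eq_mul_inv, div_le_iff₀ (by positivity), inv_mul_eq_div, le_div_iff₀ (by positivity),
      ← pow_succ]
    exact pow_le_pow_right₀ hD' hlt
  refine h.congr' ?_ EventuallyEq.rfl
  filter_upwards [eventually_ge_atTop 1] with D hD
  have hD' : (D : ℝ) ≠ 0 := by positivity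
  rw [← Finset.add_sum_erase t _ hi₀, mul_add, mul_inv_cancel₀ (pow_ne_zero _ hD'),
    ← Finset.mul_sum, add_sub_cancel_left]

end RTN

/-! ### From the unique ground state to the asymptotics -/

namespace NetworkGraph

open RTN

variable {V E : Type*} [Fintype V] [DecidableEq V] [Fintype E] [DecidableEq E]
  (G : NetworkGraph V E)

lemma mem_piFinset_allowedSpins {A B C : Finset V} {σ : V → Perm (Fin 4)}
    (hσ : IsAdmissible A B C σ) {s : V → Perm (Fin 4)}
    (hs : s ∈ Fintype.piFinset (allowedSpins (A ∪ B ∪ C) σ)) : IsAdmissible A B C s := by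
  have h (v : V) (hv : v ∈ A ∪ B ∪ C) : s v = σ v := by
    have := Fintype.mem_piFinset.1 hs v
    rwa [allowedSpins, if_pos hv, Finset.mem_singleton] at this
  exact ⟨fun v hv => (h v (by simp [hv])).trans (hσ.1 v hv),
    fun v hv => (h v (by simp [hv])).trans (hσ.2.1 v hv),
    fun v hv => (h v (by simp [hv])).trans (hσ.2.2 v hv)⟩

lemma self_mem_piFinset_allowedSpins {n : ℕ} (bdry : Finset V) (σ : V → Perm (Fin n)) :
    σ ∈ Fintype.piFinset (allowedSpins bdry σ) := by
  refine Fintype.mem_piFinset.2 fun v => ?_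
  rw [allowedSpins]
  split_ifs <;> simp

/-- If the configuration of minimal energy is unique then no bulk vertex is isolated. -/
lemma degree_ne_zero {A B C : Finset V} {s : V → Perm (Fin 4)} (hs : IsAdmissible A B C s)
    (hlt : ∀ t : V → Perm (Fin 4), IsAdmissible A B C t → t ≠ s → G.energy s < G.energy t)
    {v : V} (hv : v ∉ A ∪ B ∪ C) : G.degree v ≠ 0 := by
  intro h0
  rw [degree, Fintype.card_eq_zero_iff] at h0
  -- No edge sees the spin at `v`, so changing it costs no energy and contradicts uniqueness.
  obtain ⟨π, hπ⟩ := exists_ne (s v)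
  set t := Function.update s v π
  have hne (w : V) (hw : w ∈ A ∪ B ∪ C) : t w = s w :=
    Function.update_of_ne (ne_of_mem_of_not_mem hw hv) _ _
  have ht : IsAdmissible A B C t :=
    ⟨fun w hw => (hne w (by simp [hw])).trans (hs.1 w hw),
      fun w hw => (hne w (by simp [hw])).trans (hs.2.1 w hw),
      fun w hw => (hne w (by simp [hw])).trans (hs.2.2 w hw)⟩
  have hlt := hlt t ht fun h => hπ (by rw [← h]; simp [t])
  have hends (e : E) (i : Fin 2) : t (G.ends e i) = s (G.ends e i) :=
    Function.update_of_ne (fun h => h0.false ⟨(e, i), by simpa using h⟩) _ _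
  simp only [energy, hends, lt_irrefl] at hlt

end NetworkGraph

theorem theorem3p1 {V E : Type*} [Fintype V] [DecidableEq V] [Fintype E] [DecidableEq E]
    (G : NetworkGraph V E) (A B C : Finset V)
    (hAB : Disjoint A B) (hBC : Disjoint B C) (hAC : Disjoint A C)
    (ΓA ΓB ΓC : Finset V)
    (hmin : G.IsMinimalTripartition A B C ΓA ΓB ΓC)
    (hunique : ∀ ΔA ΔB ΔC : Finset V, G.IsMinimalTripartition A B C ΔA ΔB ΔC →
      ΔA = ΓA ∧ ΔB = ΓB ∧ ΔC = ΓC) :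
    (∃ ε : ℕ → ℝ, (ε =O[atTop] fun D : ℕ => (D : ℝ)⁻¹) ∧
      ∀ D : ℕ, 1 ≤ D → G.expectedZ A B C D =
        (((D : ℝ) ^ (-2 * ((G.cutEdges ΓA ΓB ΓC).card : ℤ)) * (1 + ε D) : ℝ) : ℂ)) ∧
    (∃ s : V → Equiv.Perm (Fin 4),
      (∀ v ∈ ΓA, s v = RTN.klein1) ∧ (∀ v ∈ ΓB, s v = RTN.klein2) ∧
      (∀ v ∈ ΓC, s v = RTN.klein3) ∧
      NetworkGraph.IsAdmissible A B C s ∧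
      G.energy s = 2 * (G.cutEdges ΓA ΓB ΓC).card ∧
      ∀ t : V → Equiv.Perm (Fin 4), NetworkGraph.IsAdmissible A B C t → t ≠ s →
        G.energy s < G.energy t) := by
  obtain ⟨s, hA, hB, hC, hadm, hen, hlt⟩ := hmin.exists_unique_min_energy G hunique
  refine ⟨?_, s, hA, hB, hC, hadm, hen, hlt⟩
  set γ := (G.cutEdges ΓA ΓB ΓC).card
  -- `ε` is chosen as the exact relative error, so the formula for each `D ≥ 1` is algebra and only
  -- the bound on `ε` is asymptotic. The ground state `s` also serves as the reference for the
  -- boundary spins.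
  refine ⟨fun D => (∏ v : {v : V // v ∉ A ∪ B ∪ C}, RTN.risingRatio 4 (D ^ G.degree v.1)) *
    ((D : ℝ) ^ G.energy s *
      ∑ t ∈ Fintype.piFinset (NetworkGraph.allowedSpins (A ∪ B ∪ C) s), ((D : ℝ) ^ G.energy t)⁻¹) - 1, ?_, fun D hD => ?_⟩
  · exact RTN.isBigO_mul_sub_one
      (RTN.isBigO_prod_sub_one _ _ fun v _ =>
        RTN.isBigO_risingRatio_sub_one (G.degree_ne_zero hadm hlt v.2))
      (RTN.isBigO_sum_sub_one (NetworkGraph.self_mem_piFinset_allowedSpins _ s) _ fun t ht =>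
        hlt t (NetworkGraph.mem_piFinset_allowedSpins hadm ht))
  · have : NeZero D := ⟨by omega⟩
    have hD0 : (D : ℂ) ≠ 0 := NeZero.ne _
    rw [G.expectedZ_eq hadm, add_sub_cancel, hen]
    push_cast
    rw [show (-2 * (γ : ℤ)) = -((2 * γ : ℕ) : ℤ) by push_cast; ring, zpow_neg, zpow_natCast]
    field_simp
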